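/- \textbf{Setting.} Let $\mu$ be a $\sigma$-finite measure on a measurable space $\mathcal Y$, $\Theta\subseteq\mathbb R^p$, and for $i=1,2,\dots$ and $\theta\in\Theta$ let $f_i(\cdot;\theta)$ be a probability density with respect to $\mu$; all integrals $\int\cdots$ are with respect to $\mu$. For $\gamma\ge 0$ the density power divergence of two densities is $$d_\gamma(f_1,f_2)=\int\Big[f_2^{1+\gamma}-\big(1+\tfrac1\gamma\big)f_2^{\gamma}f_1+\tfrac1\gamma f_1^{1+\gamma}\Big]\ (\gamma>0),\qquad d_0(f_1,f_2)=\int f_1\log(f_1/f_2).$$ Fix $\tau,\gamma\ge0$. Let $u_i(y;\theta)=\nabla\log f_i(y;\theta)$ and $V_i(y;\theta)=\int f_i(\cdot;\theta)^{1+\tau}-(1+\frac1\tau)f_i(y;\theta)^\tau$ for $\tau>0$, $V_i(y;\theta)=-\log f_i(y;\theta)$ for $\tau=0$. For densities $g=(g_i)$ let $$J^{(i)}(\theta)=\int u_iu_i^Tf_i^{1+\tau}-\int(\nabla u_i+\tau u_iu_i^T)(g_i-f_i)f_i^\tau,\qquad \xi_i=\int u_if_i^\tau g_i,$$ $$\Psi_n(\theta)=\frac1n\sum_{i=1}^nJ^{(i)}(\theta),\qquad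 \Omega_n(\theta)=\frac1n\sum_{i=1}^n\Big[\int u_iu_i^Tf_i^{2\tau}g_i-\xi_i\xi_i^T\Big].$$ \textbf{Test.} For $H_0:\theta=\theta_0$ against $H_1:\theta\ne\theta_0$ based on independent $Y_1,\dots,Y_n$, let $T_\gamma(\theta,\theta_0)=2\sum_{i=1}^nd_\gamma(f_i(\cdot;\theta),f_i(\cdot;\theta_0))$ and let $\theta_n^\tau$ be the minimum density power divergence estimator: a consistent sequence of ($\Theta$-valued, measurable) estimators solving, with probability tending to one, the estimating equation $\sum_{i=1}^n\big[f_i(Y_i;\theta)^\tau u_i(Y_i;\theta)-\int f_i(\cdot;\theta)^{1+\tau}u_i(\cdot;\theta)\big]=0$. \textbf{Conditions.} Let $\theta_0\in\Theta$, and $\theta^*\in\Theta$ with $\theta^*\neq\theta_0$. Assume that the following Ghosh--Basu and Lehmann conditions hold at $\theta_t=\theta_0$ and at $\theta_t=\theta^*$ (with $g_i=f_i(\cdot;\theta_t)$, $E_{g_i}$ the expectation under $g_i$, and $\omega$ some open subset of $\Theta$ containing $\theta_t$, possibly different for the two sets of conditions). \emph{Ghosh--Basu.} (A1) The support $\chi=\{y: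 f_i(y;\theta)>0\}$ does not depend (up to $\mu$-null sets) on $i$ and $\theta$. (A2) For almost all $y\in\chi$ and all $i$, $f_i(y;\cdot)$ is three times differentiable on $\omega$ with continuous third partial derivatives. (A3) On $\omega$, $\int f_i^{1+\tau}$ and $\int f_i^\tau g_i$ can be differentiated three times under the integral sign. (A4) The integrals defining $J^{(i)}(\theta_t)$, $\xi_i$ and $\Omega_n(\theta_t)$ exist, every $J^{(i)}(\theta_t)$ is positive definite, and $\inf_n\lambda_{\min}(\Psi_n(\theta_t))>0$. (A5) For all $j,k,l$ there are $M^{(i)}_{jkl}$ with $|\nabla_{jkl}V_i(y;\theta)|\le M^{(i)}_{jkl}(y)$ for $\theta\in\omega$ and $g_i$-almost all $y$, and $\frac1n\sum_{i\le n}E_{g_i}M^{(i)}_{jkl}=O(1)$. (A6) For all $j,k$, with $W_i=\nabla_jV_i(Y;\theta_t)$ and with $W_i=\nabla_{jk}V_i(Y;\theta_t)-E_{g_i}\nabla_{jk}V_i(Y;\theta_t)$, $\lim_{N\to\infty}\sup_{n>1}\frac1n\sum_{i\le n}E_{g_i}[|W_i|1(|W_i|>N)]=0$. (A7) $\Omega_n=\Omega_n(\theta_t)$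 is positive definite for large $n$, and for every $\varepsilon>0$, with $W_{n,i}=\|\Omega_n^{-1/2}\nabla V_i(Y;\theta_t)\|$, $\frac1n\sum_{i\le n}E_{g_i}[W_{n,i}^21(W_{n,i}>\varepsilon\sqrt n)]\to0$. \emph{Lehmann.} (A) For almost all $y$, every $f_i(y;\cdot)$ is three times differentiable on $\omega$. (B) For all $i$ and $\theta\in\omega$, $E_\theta[u_i]=0$ and $I_i(\theta):=E_\theta[u_iu_i^T]=E_\theta[-\nabla^2\log f_i]$, all these expectations being finite. (C) $I_i(\theta)$ is finite and positive definite for all $i$ and $\theta\in\omega$. (D) For all $i,j,k,l$, $\sup_{\theta\in\omega}|\nabla_{jkl}\log f_i(y;\theta)|$ is bounded, for almost every $y$ under $f_i(\cdot;\theta_t)$, by a function of $y$ with finite expectation under $f_i(\cdot;\theta_t)$. Assume further, element-wise as $n\to\infty$: (C1) for $\theta=\theta_0$ and for $\theta=\theta^*$ (with $g_i=f_i(\cdot;\theta)$), $\Psi_n(\theta)\to J_\tau(\theta)$ and $\Omega_n(\theta)\to V_\tau(\theta)$; (C2) the divergences $d_\gamma(f_i(\cdot;\theta),f_i(\cdot;\theta_0))$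 are finite and differentiable in $\theta$ near $\theta_0$, twice differentiable at $\theta_0$, and $\frac1n\sum_{i\le n}\nabla^2_\theta d_\gamma(f_i(\cdot;\theta),f_i(\cdot;\theta_0))|_{\theta=\theta_0}\to A_\gamma(\theta_0)$; (C3) these divergences are finite for $\theta$ near $\theta^*$ and differentiable at $\theta^*$, and $\frac1n\sum_{i\le n}\nabla_\theta d_\gamma(f_i(\cdot;\theta),f_i(\cdot;\theta_0))|_{\theta=\theta^*}$ converges. \textbf{Critical value.} For $0<\alpha<1$ let $t_\alpha^{\tau,\gamma}$ be the $(1-\alpha)$-quantile of the asymptotic null distribution of the test statistic, i.e. of $\sum_k\zeta_kZ_k^2$, where the $Z_k$ are independent standard normal and the $\zeta_k$ are the nonzero eigenvalues, with multiplicity, of $A_\gamma(\theta_0)J_\tau(\theta_0)^{-1}V_\tau(\theta_0)J_\tau(\theta_0)^{-1}$. \textbf{Claim (consistency).} Suppose that $\frac1n\sum_{i=1}^nd_\gamma(f_i(\cdot;\theta^*),f_i(\cdot;\theta_0))$ is of exact order one, i.e. for some constants $0<c\le C<\infty$ it lies in $[c,C]$ for all large $n$. Then, if the observations are independent with $Y_i\sim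 f_i(\cdot;\theta^*)$, the probability of rejecting $H_0$ tends to one for every fixed level $\alpha\in(0,1)$: $$P_{\theta^*}\big(T_\gamma(\theta_n^\tau,\theta_0)>t_\alpha^{\tau,\gamma}\big)\to1\qquad(n\to\infty).$$ Thus the test is consistent. -/

import Mathlib

open MeasureTheory ProbabilityTheory Filter Topology Asymptotics
open scoped ENNReal Matrix

noncomputable section

namespace DPDTest

/-- Parameters live in `ℝ^p` with the Euclidean norm. -/
abbrev Param (p : ℕ) : Type := EuclideanSpace ℝ (Fin p)

/-- The distribution with density `g` with respect to the dominating measure `μ`. -/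
def law {S : Type*} [MeasurableSpace S] (μ : Measure S) (g : S → ℝ) : Measure S :=
  μ.withDensity (fun y => ENNReal.ofReal (g y))

/-- `f i θ` is, for every observation index `i` and every `θ ∈ Θ`, a probability density
with respect to `μ`. -/
def IsDensityFamily {p : ℕ} {S : Type*} [MeasurableSpace S] (μ : Measure S)
    (Θ : Set (Param p)) (f : ℕ → Param p → S → ℝ) : Prop :=
  ∀ i, ∀ θ ∈ Θ, Measurable (f i θ) ∧ (∀ y, 0 ≤ f i θ y) ∧
    ∫⁻ y, ENNReal.ofReal (f i θ y) ∂μ = 1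

/-- The `j`-th partial derivative of `φ` (as a function of the parameter). -/
def pd {p : ℕ} (j : Fin p) (φ : Param p → ℝ) (θ : Param p) : ℝ :=
  fderiv ℝ φ θ (EuclideanSpace.single j 1)

/-- Three times differentiable at every point of the (open) set `U`. -/
def ThriceDiffOn {p : ℕ} (φ : Param p → ℝ) (U : Set (Param p)) : Prop :=
  ∀ θ ∈ U, DifferentiableAt ℝ φ θ ∧ (∀ j, DifferentiableAt ℝ (pd j φ) θ) ∧
    ∀ j k, DifferentiableAt ℝ (pd k (pd j φ)) θ

/-- `θ ↦ ∫ φ θ y dμ(y)` is three times differentiable on `U`, and the derivatives up to order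
three may be taken under the integral sign. -/
def ThriceDiffUnderIntegral {p : ℕ} {S : Type*} [MeasurableSpace S] (μ : Measure S)
    (U : Set (Param p)) (φ : Param p → S → ℝ) : Prop :=
  ThriceDiffOn (fun θ => ∫ y, φ θ y ∂μ) U ∧
  ∀ θ ∈ U, Integrable (φ θ) μ ∧ ∀ j k l : Fin p,
    Integrable (fun y => pd j (fun η => φ η y) θ) μ ∧
    Integrable (fun y => pd k (pd j (fun η => φ η y)) θ) μ ∧
    Integrable (fun y => pd l (pd k (pd j (fun η => φ η y))) θ) μ ∧
    pd j (fun η => ∫ y, φ η y ∂μ) θ = ∫ y, pd j (fun η => φ η y) θ ∂μ ∧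
    pd k (pd j (fun η => ∫ y, φ η y ∂μ)) θ = ∫ y, pd k (pd j (fun η => φ η y)) θ ∂μ ∧
    pd l (pd k (pd j (fun η => ∫ y, φ η y ∂μ))) θ
      = ∫ y, pd l (pd k (pd j (fun η => φ η y))) θ ∂μ

/-! ### Density power divergence and the test statistic -/

/-- The density power divergence `d_γ(f₁, f₂)`, `γ ≥ 0`, with values in `[0, ∞]`. For `γ > 0` the
integrand is nonnegative when `f₁, f₂ ≥ 0`; for `γ = 0` it is the Kullback-Leibler divergence
`∫ f₁ log (f₁ / f₂)`. -/
def dpd {S : Type*} [MeasurableSpace S] (μ : Measure S) (γ : ℝ) (f₁ f₂ : S → ℝ) : ℝ≥0∞ :=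
  if γ = 0 then InformationTheory.klDiv (law μ f₁) (law μ f₂)
  else ∫⁻ y, ENNReal.ofReal
    (f₂ y ^ (1 + γ) - (1 + 1 / γ) * f₂ y ^ γ * f₁ y + 1 / γ * f₁ y ^ (1 + γ)) ∂μ

/-- `(1/n) ∑_{i<n} d_γ(f_i(·;θ), f_i(·;θ₀))`. -/
def avgDPD {p : ℕ} {S : Type*} [MeasurableSpace S] (μ : Measure S)
    (f : ℕ → Param p → S → ℝ) (γ : ℝ) (θ₀ : Param p) (n : ℕ) (θ : Param p) : ℝ≥0∞ :=
  (n : ℝ≥0∞)⁻¹ * ∑ i ∈ Finset.range n, dpd μ γ (f i θ) (f i θ₀)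

/-- The test statistic `T_γ(θ, θ₀) = 2 ∑_{i<n} d_γ(f_i(·;θ), f_i(·;θ₀))`; it is used with
`θ = θ_n^τ`. -/
def testStat {p : ℕ} {S : Type*} [MeasurableSpace S] (μ : Measure S)
    (f : ℕ → Param p → S → ℝ) (γ : ℝ) (θ₀ : Param p) (n : ℕ) (θ : Param p) : ℝ≥0∞ :=
  2 * ∑ i ∈ Finset.range n, dpd μ γ (f i θ) (f i θ₀)

/-! ### Score, estimating equation, and the matrices -/

/-- `j`-th component of the score `u_i(y;θ) = ∇ log f_i(y;θ)`. -/
def score {p : ℕ} {S : Type*} (f : ℕ → Param p → S → ℝ) (i : ℕ) (j : Fin p)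
    (θ : Param p) (y : S) : ℝ :=
  pd j (fun η => Real.log (f i η y)) θ

/-- `θ` solves the minimum density power divergence estimating equation for the sample `y`. -/
def EstimatingEq {p : ℕ} {S : Type*} [MeasurableSpace S] (μ : Measure S)
    (f : ℕ → Param p → S → ℝ) (τ : ℝ) (n : ℕ) (y : Fin n → S) (θ : Param p) : Prop :=
  ∀ j : Fin p, ∑ i : Fin n, (f i θ (y i) ^ τ * score f i j θ (y i)
    - ∫ x, f i θ x ^ (1 + τ) * score f i j θ x ∂μ) = 0

/-- The summand `V_i(y;θ)` of the objective function (for `τ = 0`, its limiting form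
`- log f_i(y;θ)`). -/
def objTerm {p : ℕ} {S : Type*} [MeasurableSpace S] (μ : Measure S)
    (f : ℕ → Param p → S → ℝ) (τ : ℝ) (i : ℕ) (y : S) (θ : Param p) : ℝ :=
  if τ = 0 then - Real.log (f i θ y)
  else (∫ x, f i θ x ^ (1 + τ) ∂μ) - (1 + 1 / τ) * f i θ y ^ τ

/-- `J^{(i)}(θ)` for the true densities `g`. -/
def JMat {p : ℕ} {S : Type*} [MeasurableSpace S] (μ : Measure S)
    (f : ℕ → Param p → S → ℝ) (τ : ℝ) (g : ℕ → S → ℝ) (i : ℕ) (θ : Param p) :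
    Matrix (Fin p) (Fin p) ℝ :=
  Matrix.of fun j k =>
    (∫ y, score f i j θ y * score f i k θ y * f i θ y ^ (1 + τ) ∂μ)
    - ∫ y, (pd k (fun η => score f i j η y) θ + τ * (score f i j θ y * score f i k θ y))
        * (g i y - f i θ y) * f i θ y ^ τ ∂μ

/-- `Ψ_n^τ(θ) = (1/n) ∑_{i<n} J^{(i)}(θ)`. -/
def PsiMat {p : ℕ} {S : Type*} [MeasurableSpace S] (μ : Measure S)
    (f : ℕ → Param p → S → ℝ) (τ : ℝ) (g : ℕ → S → ℝ) (n : ℕ) (θ : Param p) :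
    Matrix (Fin p) (Fin p) ℝ :=
  (n : ℝ)⁻¹ • ∑ i ∈ Finset.range n, JMat μ f τ g i θ

/-- `j`-th component of `ξ_i = ∫ u_i f_i^τ g_i`. -/
def xiVec {p : ℕ} {S : Type*} [MeasurableSpace S] (μ : Measure S)
    (f : ℕ → Param p → S → ℝ) (τ : ℝ) (g : ℕ → S → ℝ) (i : ℕ) (θ : Param p) (j : Fin p) : ℝ :=
  ∫ y, score f i j θ y * f i θ y ^ τ * g i y ∂μ

/-- `Ω_n^τ(θ) = (1/n) ∑_{i<n} [∫ u_i u_iᵀ f_i^{2τ} g_i - ξ_i ξ_iᵀ]`. -/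
def OmegaMat {p : ℕ} {S : Type*} [MeasurableSpace S] (μ : Measure S)
    (f : ℕ → Param p → S → ℝ) (τ : ℝ) (g : ℕ → S → ℝ) (n : ℕ) (θ : Param p) :
    Matrix (Fin p) (Fin p) ℝ :=
  (n : ℝ)⁻¹ • ∑ i ∈ Finset.range n, Matrix.of fun j k =>
    (∫ y, score f i j θ y * score f i k θ y * f i θ y ^ (2 * τ) * g i y ∂μ)
      - xiVec μ f τ g i θ j * xiVec μ f τ g i θ k

/-! ### Regularity conditions -/

/-- The Ghosh-Basu conditions (A1)-(A7) for true densities `g`, best fitting parameter `θg`,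
common support `χ` and open set `U` (called `ω` in the literature). The conditions on derivatives
in `θ` are only required on `U`. -/
structure GhoshBasuOn {p : ℕ} {S : Type*} [MeasurableSpace S] (μ : Measure S)
    (Θ : Set (Param p)) (f : ℕ → Param p → S → ℝ) (τ : ℝ) (g : ℕ → S → ℝ) (θg : Param p)
    (χ : Set S) (U : Set (Param p)) : Prop where
  /-- (A1), model part -/
  support_model : ∀ i, ∀ θ ∈ Θ, ∀ᵐ y ∂μ, (0 < f i θ y ↔ y ∈ χ)
  /-- (A1), true distributions -/
  support_true : ∀ i, ∀ᵐ y ∂μ, y ∉ χ → g i y = 0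
  /-- (A2) -/
  isOpen : IsOpen U
  subset : U ⊆ Θ
  mem : θg ∈ U
  smooth : ∀ᵐ y ∂μ, y ∈ χ → ∀ i, ContDiffOn ℝ 3 (fun θ => f i θ y) U
  /-- (A3) -/
  diff_under_int₁ : ∀ i, ThriceDiffUnderIntegral μ U (fun θ y => f i θ y ^ (1 + τ))
  diff_under_int₂ : ∀ i, ThriceDiffUnderIntegral μ U (fun θ y => f i θ y ^ τ * g i y)
  /-- the integrals defining `J^{(i)}`, `ξ_i` and `Ω_n` at `θg` exist -/
  integrable_J₁ : ∀ i j k, Integrable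
    (fun y => score f i j θg y * score f i k θg y * f i θg y ^ (1 + τ)) μ
  integrable_J₂ : ∀ i j k, Integrable
    (fun y => (pd k (fun η => score f i j η y) θg + τ * (score f i j θg y * score f i k θg y))
        * (g i y - f i θg y) * f i θg y ^ τ) μ
  integrable_xi : ∀ i j, Integrable (fun y => score f i j θg y * f i θg y ^ τ * g i y) μ
  integrable_Omega : ∀ i j k, Integrable
    (fun y => score f i j θg y * score f i k θg y * f i θg y ^ (2 * τ) * g i y) μ
  /-- (A4): each `J^{(i)}` is positive definite, and the smallest eigenvalues of the `Ψ_n` are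
  bounded below by a positive constant -/
  posDef_J : ∀ i, (JMat μ f τ g i θg).PosDef
  eigen_Psi : ∃ lam : ℝ, 0 < lam ∧ ∀ n : ℕ, 1 ≤ n →
    (PsiMat μ f τ g n θg - lam • (1 : Matrix (Fin p) (Fin p) ℝ)).PosSemidef
  /-- (A5) -/
  third_bound : ∀ j k l : Fin p, ∃ M : ℕ → S → ℝ,
    (∀ i, ∀ᵐ y ∂(law μ (g i)), ∀ θ ∈ U, |pd j (pd k (pd l (objTerm μ f τ i y))) θ| ≤ M i y) ∧
    (∀ i, Integrable (M i) (law μ (g i))) ∧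
    (fun n : ℕ => (n : ℝ)⁻¹ * ∑ i ∈ Finset.range n, ∫ y, M i y ∂(law μ (g i)))
      =O[atTop] (fun _ => (1 : ℝ))
  /-- (A6), first derivatives -/
  unif_int₁ : ∀ j : Fin p, Tendsto (fun N : ℝ => ⨆ n : ℕ, ⨆ _ : 1 < n,
    (n : ℝ≥0∞)⁻¹ * ∑ i ∈ Finset.range n,
      ∫⁻ y in {y | N < |pd j (objTerm μ f τ i y) θg|},
        ENNReal.ofReal |pd j (objTerm μ f τ i y) θg| ∂(law μ (g i))) atTop (𝓝 0)
  /-- (A6), centred second derivatives -/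
  unif_int₂ : ∀ j k : Fin p, Tendsto (fun N : ℝ => ⨆ n : ℕ, ⨆ _ : 1 < n,
    (n : ℝ≥0∞)⁻¹ * ∑ i ∈ Finset.range n,
      ∫⁻ y in {y | N < |pd j (pd k (objTerm μ f τ i y)) θg
          - ∫ x, pd j (pd k (objTerm μ f τ i x)) θg ∂(law μ (g i))|},
        ENNReal.ofReal |pd j (pd k (objTerm μ f τ i y)) θg
          - ∫ x, pd j (pd k (objTerm μ f τ i x)) θg ∂(law μ (g i))| ∂(law μ (g i)))
    atTop (𝓝 0)
  /-- (A7): `Ω_n` is positive definite (for large `n`), and the Lindeberg condition holds;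
  `‖Ω^{-1/2} v‖² = vᵀ Ω⁻¹ v` -/
  posDef_Omega : ∀ᶠ n in atTop, (OmegaMat μ f τ g n θg).PosDef
  lindeberg : ∀ ε : ℝ, 0 < ε → Tendsto (fun n : ℕ =>
    (n : ℝ≥0∞)⁻¹ * ∑ i ∈ Finset.range n,
      ∫⁻ y in {y | ε * Real.sqrt n <
          Real.sqrt ((fun j => pd j (objTerm μ f τ i y) θg) ⬝ᵥ
            ((OmegaMat μ f τ g n θg)⁻¹ *ᵥ fun j => pd j (objTerm μ f τ i y) θg))},
        ENNReal.ofReal ((fun j => pd j (objTerm μ f τ i y) θg) ⬝ᵥ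
            ((OmegaMat μ f τ g n θg)⁻¹ *ᵥ fun j => pd j (objTerm μ f τ i y) θg))
        ∂(law μ (g i))) atTop (𝓝 0)

/-- The Ghosh-Basu conditions when the model is correct with true parameter `θ`,
that is, `g_i = f_i(·;θ)` (and the best fitting parameter is `θ`). -/
def GhoshBasuConditions {p : ℕ} {S : Type*} [MeasurableSpace S] (μ : Measure S)
    (Θ : Set (Param p)) (f : ℕ → Param p → S → ℝ) (τ : ℝ) (θ : Param p) : Prop :=
  ∃ (χ : Set S) (U : Set (Param p)), GhoshBasuOn μ Θ f τ (fun i => f i θ) θ χ U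

/-- Fisher information `I_i(θ)` of the `i`-th observation. -/
def fisherInfo {p : ℕ} {S : Type*} [MeasurableSpace S] (μ : Measure S)
    (f : ℕ → Param p → S → ℝ) (i : ℕ) (θ : Param p) : Matrix (Fin p) (Fin p) ℝ :=
  Matrix.of fun j k => ∫ y, score f i j θ y * score f i k θ y ∂(law μ (f i θ))

/-- The Lehmann conditions (A)-(D) with true parameter `θt` and open set `U`. -/
structure LehmannOn {p : ℕ} {S : Type*} [MeasurableSpace S] (μ : Measure S)
    (Θ : Set (Param p)) (f : ℕ → Param p → S → ℝ) (θt : Param p) (U : Set (Param p)) : Prop where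
  /-- (A) -/
  isOpen : IsOpen U
  subset : U ⊆ Θ
  mem : θt ∈ U
  smooth : ∀ᵐ y ∂μ, ∀ i, ThriceDiffOn (fun θ => f i θ y) U
  /-- (B) -/
  score_integrable : ∀ i, ∀ θ ∈ U, ∀ j, Integrable (score f i j θ) (law μ (f i θ))
  score_mean : ∀ i, ∀ θ ∈ U, ∀ j, ∫ y, score f i j θ y ∂(law μ (f i θ)) = 0
  hess_integrable : ∀ i, ∀ θ ∈ U, ∀ j k,
    Integrable (fun y => pd k (fun η => score f i j η y) θ) (law μ (f i θ))
  info_eq : ∀ i, ∀ θ ∈ U, ∀ j k,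
    fisherInfo μ f i θ j k = ∫ y, - pd k (fun η => score f i j η y) θ ∂(law μ (f i θ))
  /-- (C) -/
  info_finite : ∀ i, ∀ θ ∈ U, ∀ j k,
    Integrable (fun y => score f i j θ y * score f i k θ y) (law μ (f i θ))
  info_posDef : ∀ i, ∀ θ ∈ U, (fisherInfo μ f i θ).PosDef
  /-- (D); the dominating function may depend on `i` -/
  third_bound : ∀ i, ∀ j k l : Fin p, ∃ M : S → ℝ, Integrable M (law μ (f i θt)) ∧
    ∀ᵐ y ∂(law μ (f i θt)), ∀ θ ∈ U, |pd j (pd k (pd l (fun η => Real.log (f i η y)))) θ| ≤ M y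

/-- The Lehmann conditions with true parameter `θ`. -/
def LehmannConditions {p : ℕ} {S : Type*} [MeasurableSpace S] (μ : Measure S)
    (Θ : Set (Param p)) (f : ℕ → Param p → S → ℝ) (θ : Param p) : Prop :=
  ∃ U : Set (Param p), LehmannOn μ Θ f θ U

/-- Condition (C1) at `θ` (with `g_i = f_i(·;θ)`): `Ψ_n^τ(θ) → J` and `Ω_n^τ(θ) → V`
element-wise. -/
def CondC1 {p : ℕ} {S : Type*} [MeasurableSpace S] (μ : Measure S)
    (f : ℕ → Param p → S → ℝ) (τ : ℝ) (θ : Param p) (J V : Matrix (Fin p) (Fin p) ℝ) : Prop :=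
  (∀ j k, Tendsto (fun n => PsiMat μ f τ (fun i => f i θ) n θ j k) atTop (𝓝 (J j k))) ∧
  (∀ j k, Tendsto (fun n => OmegaMat μ f τ (fun i => f i θ) n θ j k) atTop (𝓝 (V j k)))

/-- Condition (C2) at `θ₀`: the Hessians `A_γ^{(i)}(θ₀)` of `θ ↦ d_γ(f_i(·;θ), f_i(·;θ₀))` at `θ₀`
exist, and their averages converge element-wise to `A`. -/
def CondC2 {p : ℕ} {S : Type*} [MeasurableSpace S] (μ : Measure S)
    (f : ℕ → Param p → S → ℝ) (γ : ℝ) (θ₀ : Param p) (A : Matrix (Fin p) (Fin p) ℝ) : Prop :=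
  (∀ i, (∀ᶠ θ in 𝓝 θ₀, dpd μ γ (f i θ) (f i θ₀) ≠ ∞ ∧
      DifferentiableAt ℝ (fun η => (dpd μ γ (f i η) (f i θ₀)).toReal) θ) ∧
    ∀ j, DifferentiableAt ℝ (pd j (fun η => (dpd μ γ (f i η) (f i θ₀)).toReal)) θ₀) ∧
  ∀ j k, Tendsto (fun n : ℕ => (n : ℝ)⁻¹ * ∑ i ∈ Finset.range n,
      pd k (pd j (fun η => (dpd μ γ (f i η) (f i θ₀)).toReal)) θ₀) atTop (𝓝 (A j k))

/-- Condition (C3) at `θ`: the gradients `M_γ^{(i)}(θ)` of `θ ↦ d_γ(f_i(·;θ), f_i(·;θ₀))` at `θ`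
exist, and their averages converge element-wise to `M`. -/
def CondC3 {p : ℕ} {S : Type*} [MeasurableSpace S] (μ : Measure S)
    (f : ℕ → Param p → S → ℝ) (γ : ℝ) (θ₀ θ : Param p) (M : Fin p → ℝ) : Prop :=
  (∀ i, (∀ᶠ η in 𝓝 θ, dpd μ γ (f i η) (f i θ₀) ≠ ∞) ∧
    DifferentiableAt ℝ (fun η => (dpd μ γ (f i η) (f i θ₀)).toReal) θ) ∧
  ∀ j, Tendsto (fun n : ℕ => (n : ℝ)⁻¹ * ∑ i ∈ Finset.range n,
      pd j (fun η => (dpd μ γ (f i η) (f i θ₀)).toReal) θ) atTop (𝓝 (M j))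

/-! ### Critical value -/

/-- `Σ_τ = J⁻¹ V J⁻¹`. -/
def SigmaMat {p : ℕ} (J V : Matrix (Fin p) (Fin p) ℝ) : Matrix (Fin p) (Fin p) ℝ :=
  J⁻¹ * V * J⁻¹

/-- The asymptotic null distribution of the test statistic: the law of `∑ ζ_k Z_k²`, where the
`ζ_k` are the nonzero eigenvalues of `A Σ_τ` (with multiplicity) and the `Z_k` are independent
standard normal variables. -/
def nullLaw {p : ℕ} (A J V : Matrix (Fin p) (Fin p) ℝ) : Measure ℝ :=
  let ζ : List ℝ := (((A * SigmaMat J V).charpoly.roots).filter (fun x => x ≠ 0)).toList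
  (Measure.pi (fun _ : Fin ζ.length => gaussianReal 0 1)).map (fun z => ∑ k, ζ.get k * z k ^ 2)

/-- The `(1-α)`-quantile `t_α` of the asymptotic null distribution. -/
def criticalValue {p : ℕ} (α : ℝ) (A J V : Matrix (Fin p) (Fin p) ℝ) : ℝ :=
  sInf {t : ℝ | 1 - α ≤ (nullLaw A J V).real (Set.Iic t)}

/-! ### Data and estimator -/

/-- Independent observations `Y_0, Y_1, …` with `Y_i ∼ f_i(·;θ)`. -/
structure IsSample {p : ℕ} {S : Type*} [MeasurableSpace S] (μ : Measure S)
    (f : ℕ → Param p → S → ℝ) (θ : Param p)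
    {X : Type*} [MeasurableSpace X] (P : Measure X) (Y : ℕ → X → S) : Prop where
  measurable : ∀ i, Measurable (Y i)
  indep : iIndepFun Y P
  law_eq : ∀ i, P.map (Y i) = law μ (f i θ)

/-- `θhat` is a minimum density power divergence estimator with tuning parameter `τ`, i.e. a
consistent sequence of roots of the estimating equation, when the observations are `Y` and the true
parameter is `θ`. (As usual the estimating equation only has to be solved with probability
tending to one.) -/
structure IsMDPDE {p : ℕ} {S : Type*} [MeasurableSpace S] (μ : Measure S)
    (Θ : Set (Param p)) (f : ℕ → Param p → S → ℝ) (τ : ℝ) (θ : Param p)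
    {X : Type*} [MeasurableSpace X] (P : Measure X) (Y : ℕ → X → S)
    (θhat : (n : ℕ) → (Fin n → S) → Param p) : Prop where
  measurable : ∀ n, Measurable (θhat n)
  mem : ∀ n y, θhat n y ∈ Θ
  root : Tendsto (fun n : ℕ => P {x | EstimatingEq μ f τ n (fun i => Y i x)
    (θhat n (fun i => Y i x))}) atTop (𝓝 1)
  consistent : TendstoInMeasure P (fun n x => θhat n (fun i => Y i x)) atTop (fun _ => θ)

end DPDTest

end

/-!
The statistic `T_γ(θ, θ₀) = 2 ∑_{i<n} d_γ(f_i(·;θ), f_i(·;θ₀))` is a sum of nonnegative terms, hence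
nondecreasing in the sample size `n` for fixed `θ`. At `θ = θs` it grows linearly in `n`, because
the average divergence is bounded below by a positive constant; so there is a *fixed* `m` for which
the sum of the first `m` terms at `θs` already exceeds the critical value
(`exists_lt_testStat_of_isBigO`).

By `CondC3`, each divergence is finite near `θs` and differentiable, hence continuous, at `θs`.
The partial statistic with `m` terms is therefore continuous at `θs`
(`continuousAt_testStat`) and exceeds the critical value on a whole ball around `θs`. As the
estimator is consistent, it lies in that ball with probability tending to one
(`tendsto_measure_mem_of_tendstoInMeasure`), and for `n ≥ m` the full statistic is at least
the partial one. Since `m` does not depend on `n`, no equicontinuity of the divergences in the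
index `i` is needed.
-/

namespace DPDTest

/-- Convergence in measure to a constant puts all mass asymptotically in any given neighbourhood of
that constant; the events need not be measurable. -/
theorem tendsto_measure_mem_of_tendstoInMeasure {X E : Type*} [MeasurableSpace X]
    [PseudoEMetricSpace E] {P : Measure X} [IsProbabilityMeasure P] {Z : ℕ → X → E} {a : E}
    (hZ : TendstoInMeasure P Z atTop (fun _ => a)) {U : Set E} (hU : U ∈ 𝓝 a) :
    Tendsto (fun n => P {x | Z n x ∈ U}) atTop (𝓝 1) := by
  obtain ⟨ε, hε, hball⟩ := EMetric.mem_nhds_iff.1 hU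
  have hsub : Tendsto (fun n => 1 - P {x | ε ≤ edist (Z n x) a}) atTop (𝓝 1) := by
    simpa using ENNReal.Tendsto.sub tendsto_const_nhds (hZ ε hε) (Or.inl ENNReal.one_ne_top)
  refine tendsto_of_tendsto_of_tendsto_of_le_of_le hsub tendsto_const_nhds (fun n => ?_)
    (fun n => prob_le_one)
  refine tsub_le_iff_right.2 ?_
  calc (1 : ℝ≥0∞) = P Set.univ := measure_univ.symm
    _ ≤ P ({x | Z n x ∈ U} ∪ {x | ε ≤ edist (Z n x) a}) := by
        refine measure_mono fun x _ => ?_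
        rcases lt_or_ge (edist (Z n x) a) ε with h | h
        · exact Or.inl (hball h)
        · exact Or.inr h
    _ ≤ _ := measure_union_le _ _

section

variable {p : ℕ} {S : Type*} [MeasurableSpace S] {μ : Measure S} {f : ℕ → Param p → S → ℝ}
  {γ : ℝ} {θ₀ : Param p}

theorem testStat_mono {m n : ℕ} (h : m ≤ n) (θ : Param p) :
    testStat μ f γ θ₀ m θ ≤ testStat μ f γ θ₀ n θ := by
  unfold testStat
  gcongr

theorem continuousAt_testStat {θ : Param p} {M : Fin p → ℝ} (h : CondC3 μ f γ θ₀ θ M) (n : ℕ) :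
    ContinuousAt (testStat μ f γ θ₀ n) θ := by
  have hterm (i : ℕ) : ContinuousAt (fun η => dpd μ γ (f i η) (f i θ₀)) θ := by
    refine (ENNReal.continuous_ofReal.continuousAt.comp (h.1 i).2.continuousAt).congr ?_
    filter_upwards [(h.1 i).1] with η hη
    exact ENNReal.ofReal_toReal hη
  exact ENNReal.Tendsto.const_mul (tendsto_finsetSum _ fun i _ => hterm i)
    (Or.inr ENNReal.ofNat_ne_top)

theorem two_mul_avgDPD {n : ℕ} (hn : n ≠ 0) (θ : Param p) :
    2 * (n * avgDPD μ f γ θ₀ n θ) = testStat μ f γ θ₀ n θ := by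
  unfold avgDPD testStat
  rw [← mul_assoc (n : ℝ≥0∞), ENNReal.mul_inv_cancel (by exact_mod_cast hn)
    (ENNReal.natCast_ne_top n), one_mul]

theorem exists_lt_testStat_of_isBigO {θ : Param p}
    (h : (fun _ => (1 : ℝ)) =O[atTop] fun n => (avgDPD μ f γ θ₀ n θ).toReal) (t : ℝ) :
    ∃ m, ENNReal.ofReal t < testStat μ f γ θ₀ m θ := by
  obtain ⟨C, hC, hbound⟩ := h.exists_pos
  obtain ⟨m, hm, hm0, hmt⟩ := (hbound.bound.and ((eventually_gt_atTop 0).and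
    (tendsto_natCast_atTop_atTop.eventually_gt_atTop (C * |t|)))).exists
  refine ⟨m, ?_⟩
  have havg : ENNReal.ofReal C⁻¹ ≤ avgDPD μ f γ θ₀ m θ := by
    refine ENNReal.ofReal_le_of_le_toReal ?_
    rw [inv_le_iff_one_le_mul₀' hC]
    simpa using hm
  have hlt : t < m * C⁻¹ := by
    rw [← div_eq_mul_inv, lt_div_iff₀' hC]
    exact (mul_le_mul_of_nonneg_left (le_abs_self t) hC.le).trans_lt hmt
  calc ENNReal.ofReal t < ENNReal.ofReal (m * C⁻¹) := by
        refine (ENNReal.ofReal_lt_ofReal_iff ?_).2 hlt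
        positivity
    _ = m * ENNReal.ofReal C⁻¹ := by
        rw [ENNReal.ofReal_mul (Nat.cast_nonneg m), ENNReal.ofReal_natCast]
    _ ≤ m * avgDPD μ f γ θ₀ m θ := by gcongr
    _ ≤ 2 * (m * avgDPD μ f γ θ₀ m θ) := le_mul_of_one_le_left' one_le_two
    _ = testStat μ f γ θ₀ m θ := two_mul_avgDPD hm0.ne' θ

end

end DPDTest

theorem mainTheorem8 {p : ℕ} {S : Type*} [MeasurableSpace S] (μ : Measure S) [SigmaFinite μ]
    (Θ : Set (DPDTest.Param p)) (f : ℕ → DPDTest.Param p → S → ℝ)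
    (hf : DPDTest.IsDensityFamily μ Θ f)
    (τ γ : ℝ) (hτ : 0 ≤ τ) (hγ : 0 ≤ γ)
    (θ₀ θs : DPDTest.Param p) (hθ₀ : θ₀ ∈ Θ) (hθs : θs ∈ Θ) (hne : θs ≠ θ₀)
    (hL₀ : DPDTest.LehmannConditions μ Θ f θ₀) (hLs : DPDTest.LehmannConditions μ Θ f θs)
    (hG₀ : DPDTest.GhoshBasuConditions μ Θ f τ θ₀) (hGs : DPDTest.GhoshBasuConditions μ Θ f τ θs)
    (J₀ V₀ A₀ Js Vs : Matrix (Fin p) (Fin p) ℝ) (Ms : Fin p → ℝ)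
    (hC1₀ : DPDTest.CondC1 μ f τ θ₀ J₀ V₀) (hC2₀ : DPDTest.CondC2 μ f γ θ₀ A₀)
    (hC1s : DPDTest.CondC1 μ f τ θs Js Vs) (hC3s : DPDTest.CondC3 μ f γ θ₀ θs Ms)
    (α : ℝ) (hα₀ : 0 < α) (hα₁ : α < 1)
    (horder : (fun n => (DPDTest.avgDPD μ f γ θ₀ n θs).toReal) =Θ[atTop] (fun _ => (1 : ℝ)))
    {X : Type*} [MeasurableSpace X] (P : Measure X) [IsProbabilityMeasure P] (Y : ℕ → X → S)
    (hY : DPDTest.IsSample μ f θs P Y)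
    (θhat : (n : ℕ) → (Fin n → S) → DPDTest.Param p)
    (hhat : DPDTest.IsMDPDE μ Θ f τ θs P Y θhat) :
    Tendsto (fun n : ℕ => P {x | ((DPDTest.criticalValue α A₀ J₀ V₀ : ℝ) : EReal)
        < ((DPDTest.testStat μ f γ θ₀ n (θhat n (fun i => Y i x)) : ENNReal) : EReal)})
      atTop (𝓝 1) := by
  obtain ⟨m, hm⟩ := DPDTest.exists_lt_testStat_of_isBigO horder.2
    (DPDTest.criticalValue α A₀ J₀ V₀)
  have hU := (DPDTest.continuousAt_testStat hC3s m).eventually_const_lt hm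
  refine tendsto_of_tendsto_of_tendsto_of_le_of_le'
    (DPDTest.tendsto_measure_mem_of_tendstoInMeasure hhat.consistent hU) tendsto_const_nhds ?_
    (Eventually.of_forall fun n => prob_le_one)
  filter_upwards [eventually_ge_atTop m] with n hn
  refine measure_mono fun x hx => ?_
  have hlt := lt_of_lt_of_le hx (DPDTest.testStat_mono hn (θhat n fun i => Y i x))
  -- `ENNReal.ofReal` truncates a negative real at zero, so it can only enlarge the threshold.
  refine lt_of_le_of_lt ?_ (EReal.coe_ennreal_lt_coe_ennreal_iff.2 hlt)
  rw [EReal.coe_ennreal_ofReal]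
  exact_mod_cast le_max_left _ _
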